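/- Let $(\mathcal X,\mathcal A)$ be a measurable space, let $F$ and $H$ be probability measures on it, let $\alpha>0$, and let $X_1,X_2,\ldots$ be i.i.d. random variables with distribution $F$. For $m\ge 0$ put \[ \alpha_m^*=\alpha+m,\qquad H_m^*=\frac{\alpha}{\alpha+m}H+\frac{1}{\alpha+m}\sum_{i=1}^m\delta_{X_i}, \] and let $P_m^*$ be the Dirichlet process posterior given $X_1,\ldots,X_m$ for the prior $DP(\alpha H)$, i.e. a random probability measure on $(\mathcal X,\mathcal A)$ whose conditional law given $X_1,\ldots,X_m$ is $DP(\alpha_m^*H_m^*)$. Here $P\sim DP(aG)$ (with $a>0$ and $G$ a probability measure) means that for every finite measurable partition $\{A_1,\ldots,A_k\}$ of $\mathcal X$, $k\ge2$, the vector $(P(A_1),\ldots,P(A_k))$ has the Dirichlet distribution with parameters $aG(A_1),\ldots,aG(A_k)$ (coordinates with parameter $0$ being $0$ almost surely). Let $D_{\alpha m}(A)=\sqrt m\,(P_m^*(A)-H_m^*(A))$ for $A\in\mathcal A$, and let $B_F=\{B_F(A):A\in\mathcal A\}$ be an $F$-Brownian bridge, i.e. a Gaussian process with $E\,B_F(A)=0$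 and $\mathrm{Cov}(B_F(A),B_F(A'))=F(A\cap A')-F(A)F(A')$. Then, as $m\to\infty$, $D_{\alpha m}(\cdot)$ converges in distribution to $B_F(\cdot)$ in the sense of finite-dimensional distributions: for all finitely many $A_1,\ldots,A_k\in\mathcal A$ (in particular for every finite measurable partition), \[ (D_{\alpha m}(A_1),\ldots,D_{\alpha m}(A_k))\overset{d}{\longrightarrow}(B_F(A_1),\ldots,B_F(A_k)), \] both conditionally on $X_1,\ldots,X_m$, for almost every sample sequence $X_1,X_2,\ldots$, and unconditionally. -/

import Mathlib

open MeasureTheory ProbabilityTheory Filter Topology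
open scoped ENNReal

/-- The gamma law with shape `a` and rate `1`; for shape `0` it is the point mass at `0`. -/
noncomputable def gammaLaw (a : ℝ) : Measure ℝ :=
  if 0 < a then gammaMeasure a 1 else Measure.dirac 0

/-- The Dirichlet distribution `Dir(a₁, …, a_k)` with parameters `aᵢ ≥ 0`, not all zero: the law of
`(G₁, …, G_k) / (G₁ + ⋯ + G_k)`, where `G₁, …, G_k` are independent and `Gᵢ` is gamma distributed
with shape `aᵢ`. A coordinate whose parameter is zero vanishes almost surely. -/
noncomputable def dirichletMeasure {k : ℕ} (a : Fin k → ℝ) : Measure (Fin k → ℝ) :=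
  (Measure.pi fun i => gammaLaw (a i)).map fun g i => g i / ∑ j, g j

/-- `P ∼ DP(α H)` under `μ`: `P` is a random probability measure such that, for every finite
measurable partition `A₁, …, A_k` of the space with `k ≥ 2`, the random vector
`(P(A₁), …, P(A_k))` has the Dirichlet distribution with parameters `α H(A₁), …, α H(A_k)`. -/
structure IsDirichletProcess {Ω 𝒳 : Type*} [MeasurableSpace Ω] [MeasurableSpace 𝒳]
    (P : Ω → Measure 𝒳) (α : ℝ) (H : Measure 𝒳) (μ : Measure Ω) : Prop where
  aemeasurable : AEMeasurable P μ
  isProbabilityMeasure : ∀ᵐ ω ∂μ, IsProbabilityMeasure (P ω)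
  map_eq : ∀ (k : ℕ) (A : Fin k → Set 𝒳), 2 ≤ k → (∀ i, MeasurableSet (A i)) →
    Pairwise (fun i j => Disjoint (A i) (A j)) → (⋃ i, A i) = Set.univ →
    μ.map (fun ω i => (P ω).real (A i)) = dirichletMeasure (fun i => α * H.real (A i))

/-- The empirical distribution `(1/m) ∑ᵢ δ_{xᵢ}` of a sample of size `m`. -/
noncomputable def empiricalMeasure {𝒳 : Type*} [MeasurableSpace 𝒳] {m : ℕ} (x : Fin m → 𝒳) :
    Measure 𝒳 :=
  (m : ℝ≥0∞)⁻¹ • ∑ i, Measure.dirac (x i)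

/-- The posterior base distribution
`H*_m = α/(α+m) H + m/(α+m) (1/m) ∑ᵢ δ_{xᵢ}`. -/
noncomputable def posteriorBase {𝒳 : Type*} [MeasurableSpace 𝒳] (α : ℝ) (H : Measure 𝒳) {m : ℕ}
    (x : Fin m → 𝒳) : Measure 𝒳 :=
  ENNReal.ofReal (α / (α + m)) • H + ENNReal.ofReal (m / (α + m)) • empiricalMeasure x

/-- `Q` is the Dirichlet process posterior given a sample of size `m`, for the prior `DP(α H)`:
given the sample `x = (x₁, …, x_m)`, the random measure has the law `DP((α + m) H*_m)`. -/
def IsDirichletPosterior {𝒳 : Type*} [MeasurableSpace 𝒳] (α : ℝ) (H : Measure 𝒳) {m : ℕ}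
    (Q : Kernel (Fin m → 𝒳) (Measure 𝒳)) : Prop :=
  ∀ x : Fin m → 𝒳, IsDirichletProcess (fun p : Measure 𝒳 => p) (α + m) (posteriorBase α H x) (Q x)

/-- `√m (p(A) - H*_m(A))`, as a function of the sample `x` of size `m`, a value `p` of the posterior
random measure, and a set `A`. -/
noncomputable def posteriorDeviation {𝒳 : Type*} [MeasurableSpace 𝒳] (α : ℝ) (H : Measure 𝒳)
    {m : ℕ} (x : Fin m → 𝒳) (p : Measure 𝒳) (A : Set 𝒳) : ℝ :=
  √m * (p.real A - (posteriorBase α H x).real A)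

/-- `B` is an `F`-Brownian bridge under `ν`: a centered Gaussian process indexed by the measurable
sets, with `Cov(B(A), B(A')) = F(A ∩ A') - F(A) F(A')`. -/
structure IsBrownianBridge {Ω 𝒳 : Type*} [MeasurableSpace Ω] [MeasurableSpace 𝒳]
    (B : {A : Set 𝒳 // MeasurableSet A} → Ω → ℝ) (F : Measure 𝒳) (ν : Measure Ω) : Prop where
  isGaussianProcess : IsGaussianProcess B ν
  integral_eq_zero : ∀ A, ∫ ω, B A ω ∂ν = 0
  covariance_eq : ∀ A A' : {A : Set 𝒳 // MeasurableSet A},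
    cov[B A, B A'; ν] = F.real (A.1 ∩ A'.1) - F.real A.1 * F.real A'.1

/-!
Both limits are proved through characteristic functions.

Finitely many measurable sets are unions of cells of a finite partition, on which the posterior
probabilities form a Dirichlet vector with parameters `a m i = α H(Cᵢ) + #{l < m | X l ∈ Cᵢ}`, of
mean `H*_m(Cᵢ)`. By the strong law of large numbers `a m i / m → F(Cᵢ)` almost surely, so the
conditional statement is a central limit theorem for Dirichlet vectors along a deterministic sequence
of parameters (`tendsto_integral_exp_dirichletMeasure`).

A Dirichlet vector is `G / S`, with independent gamma variables `Gᵢ` of shape `a m i` and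
`S = ∑ Gⱼ`. With `c = ∑ θᵢ aᵢ / ∑ aⱼ`,
`√m ∑ θᵢ (Gᵢ / S - aᵢ / ∑ aⱼ) = (∑ (θᵢ - c) Gᵢ / √m) / (S / m)`.
The characteristic function of a gamma variable is `(1 - t * I) ^ (-a)` (`charFun_gammaMeasure`), and
expanding its logarithm to second order shows that numerator and denominator converge jointly to
`(N(0, V), 1)` (`tendstoInDistribution_pi_gammaLaw`), where `V = ∑ fᵢ θᵢ² - (∑ fᵢ θᵢ)²` and
`fᵢ = F(Cᵢ)`. This `V` is the variance of the corresponding linear combination of the Brownian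
bridge.

The unconditional characteristic function is the expectation of the conditional one, and the limit of
the latter does not depend on the sample, so dominated convergence gives the unconditional statement.
-/

/-! ### The characteristic function of the gamma law -/

theorem integrable_exp_mul_and_mgf_gammaMeasure {a : ℝ} (ha : 0 < a) {t : ℝ} (ht : t < 1) :
    Integrable (fun x => Real.exp (t * x)) (gammaMeasure a 1) ∧
      mgf id (gammaMeasure a 1) t = (1 - t) ^ (-a) := by
  have hpos : 0 < 1 - t := by linarith
  have hΓ := Real.Gamma_pos_of_pos ha
  have hfun : (fun x => (gammaPDF a 1 x).toReal • Real.exp (t * x)) =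
      (Set.Ici 0).indicator
        (fun x => (Real.Gamma a)⁻¹ * (x ^ (a - 1) * Real.exp (-((1 - t) * x)))) := by
    ext x
    rw [gammaPDF, ENNReal.toReal_ofReal (gammaPDFReal_nonneg ha one_pos x), gammaPDFReal,
      Set.indicator_apply]
    simp only [Set.mem_Ici, smul_eq_mul]
    split_ifs
    · rw [Real.one_rpow, show -((1 - t) * x) = -(1 * x) + t * x by ring, Real.exp_add]
      ring
    · simp
  have hval : ∫ x in Set.Ici (0 : ℝ), (Real.Gamma a)⁻¹ * (x ^ (a - 1) * Real.exp (-((1 - t) * x)))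
      = (1 - t) ^ (-a) := by
    rw [integral_Ici_eq_integral_Ioi, integral_const_mul,
      Real.integral_rpow_mul_exp_neg_mul_Ioi ha hpos, one_div, Real.inv_rpow hpos.le,
      Real.rpow_neg hpos.le]
    field_simp
  have hmeas : Measurable (gammaPDF a 1) := (measurable_gammaPDFReal a 1).ennreal_ofReal
  have hfin : ∀ᵐ x, gammaPDF a 1 x < ∞ := ae_of_all _ fun _ => ENNReal.ofReal_lt_top
  constructor
  · rw [gammaMeasure, integrable_withDensity_iff_integrable_smul' hmeas hfin, hfun,
      integrable_indicator_iff measurableSet_Ici]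
    by_contra h
    rw [integral_undef h] at hval
    exact (Real.rpow_pos_of_pos hpos (-a)).ne hval
  · rw [mgf, gammaMeasure, integral_withDensity_eq_integral_toReal_smul hmeas hfin]
    simp only [id]
    rw [hfun, integral_indicator measurableSet_Ici, hval]

/-- The formula follows from the one for real exponents: both sides are values at `t * I` of
functions holomorphic on the half-plane `re z < 1` that agree on its real points. -/
theorem charFun_gammaMeasure {a : ℝ} (ha : 0 < a) (t : ℝ) :
    charFun (gammaMeasure a 1) t = (1 - t * Complex.I) ^ (-a : ℂ) := by
  set U : Set ℂ := {z | z.re < 1}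
  have hU : IsPreconnected U := (convex_halfSpace_re_lt 1).isPreconnected
  have hsub : ∀ z ∈ U, z.re ∈ interior (integrableExpSet id (gammaMeasure a 1)) := by
    intro z hz
    refine mem_interior.2 ⟨Set.Iio 1, fun s hs => ?_, isOpen_Iio, hz⟩
    exact (integrable_exp_mul_and_mgf_gammaMeasure ha hs).1
  have h1 : AnalyticOnNhd ℂ (complexMGF id (gammaMeasure a 1)) U :=
    fun z hz => analyticAt_complexMGF (hsub z hz)
  have h2 : AnalyticOnNhd ℂ (fun z : ℂ => (1 - z) ^ (-a : ℂ)) U := by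
    intro z hz
    refine AnalyticAt.cpow (by fun_prop) analyticAt_const (Or.inl ?_)
    simp only [Complex.sub_re, Complex.one_re]
    have : z.re < 1 := hz
    linarith
  have h3 : ∃ᶠ z in 𝓝[≠] (0 : ℂ),
      complexMGF id (gammaMeasure a 1) z = (fun z : ℂ => (1 - z) ^ (-a : ℂ)) z := by
    have hlim : Tendsto (fun x : ℝ => (x : ℂ)) (𝓝[≠] 0) (𝓝[≠] 0) := by
      refine tendsto_nhdsWithin_iff.2 ⟨?_, ?_⟩
      · exact (Complex.continuous_ofReal.tendsto' 0 0 (by simp)).mono_left nhdsWithin_le_nhds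
      · filter_upwards [self_mem_nhdsWithin] with x hx
        simpa using hx
    refine hlim.frequently (Eventually.frequently ?_)
    filter_upwards [nhdsWithin_le_nhds (Iio_mem_nhds (zero_lt_one' ℝ))] with x hx
    have hx' : (0 : ℝ) ≤ 1 - x := by
      have : x < 1 := hx
      linarith
    rw [complexMGF_ofReal, (integrable_exp_mul_and_mgf_gammaMeasure ha hx).2,
      Complex.ofReal_cpow hx']
    push_cast
    rfl
  have h4 := h1.eqOn_of_preconnected_of_frequently_eq h2 hU (by simp [U]) h3
  rw [← complexMGF_id_mul_I]
  exact h4 (by simp [U])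

instance isProbabilityMeasure_gammaLaw (a : ℝ) : IsProbabilityMeasure (gammaLaw a) := by
  unfold gammaLaw
  split_ifs with h
  · exact isProbabilityMeasure_gammaMeasure h one_pos
  · infer_instance

theorem charFun_gammaLaw {a : ℝ} (ha : 0 ≤ a) (t : ℝ) :
    charFun (gammaLaw a) t = Complex.exp (-(a * Complex.log (1 - t * Complex.I))) := by
  rcases ha.eq_or_lt with rfl | h
  · simp [gammaLaw]
  · have hne : (1 - t * Complex.I : ℂ) ≠ 0 := by
      intro h0
      simpa using congrArg Complex.re h0
    rw [gammaLaw, if_pos h, charFun_gammaMeasure h, Complex.cpow_def_of_ne_zero hne]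
    congr 1
    ring

/-- The joint characteristic function of independent gamma variables. The logarithm is the principal
one, which is continuous along `1 - u * I`, `u` real, as this line lies in the right half-plane. -/
theorem integral_exp_pi_gammaLaw {n : ℕ} {a : Fin n → ℝ} (ha : ∀ i, 0 ≤ a i) (u : Fin n → ℝ) :
    ∫ g, Complex.exp ((∑ i, u i * g i : ℝ) * Complex.I) ∂(Measure.pi fun i => gammaLaw (a i)) =
      Complex.exp (-∑ i, a i * Complex.log (1 - u i * Complex.I)) := by
  have h : ∀ g : Fin n → ℝ, Complex.exp ((∑ i, u i * g i : ℝ) * Complex.I) =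
      ∏ i, Complex.exp (u i * g i * Complex.I) := by
    intro g
    rw [← Complex.exp_sum, ← Finset.sum_mul]
    push_cast
    rfl
  simp_rw [h]
  rw [integral_fintype_prod_eq_prod (𝕜 := ℂ)
      (fun i (x : ℝ) => Complex.exp (u i * x * Complex.I)) (μ := fun i => gammaLaw (a i)),
    ← Finset.sum_neg_distrib, Complex.exp_sum]
  refine Finset.prod_congr rfl fun i _ => ?_
  rw [← charFun_gammaLaw (ha i), charFun_apply_real]

/-! ### The Gaussian limit of centered gamma sums -/

theorem norm_log_one_sub_mul_I_le {u : ℝ} (hu : |u| ≤ 1 / 2) :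
    ‖Complex.log (1 - u * Complex.I) - (-(u * Complex.I) + u ^ 2 / 2)‖ ≤ |u| ^ 3 := by
  have hn : ‖(-(u * Complex.I) : ℂ)‖ = |u| := by simp
  have h := Complex.norm_log_sub_logTaylor_le 2 (z := -(u * Complex.I)) (by rw [hn]; linarith)
  rw [hn, ← sub_eq_add_neg] at h
  have hT : Complex.logTaylor (2 + 1) (-(u * Complex.I)) = -(u * Complex.I) + u ^ 2 / 2 := by
    simp [Complex.logTaylor, Finset.sum_range_succ, mul_pow]
    ring
  rw [hT] at h
  refine h.trans ?_
  have h2 : (1 - |u|)⁻¹ ≤ 2 := by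
    rw [inv_le_comm₀ (by linarith) two_pos]
    linarith
  have h3 : 0 ≤ |u| ^ 3 := by positivity
  norm_num
  nlinarith

/-- The second order expansion of minus the logarithm of the joint characteristic function of
`(∑ hᵢ Gᵢ / √m, ∑ Gᵢ / m)` at `(s, t)`, where `Gᵢ` is gamma with shape `a m i`. Since `h` is centered
for the weights `a m`, the linear term of order `√m` cancels exactly, so the `a m i / m` may converge
at any rate. -/
theorem tendsto_sum_mul_log {n : ℕ} {a h : ℕ → Fin n → ℝ} {f h' : Fin n → ℝ} {s t : ℝ}
    (ha : ∀ m i, 0 ≤ a m i) (haf : ∀ i, Tendsto (fun m : ℕ => a m i / m) atTop (𝓝 (f i)))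
    (hf : ∑ i, f i = 1) (hh : ∀ i, Tendsto (fun m => h m i) atTop (𝓝 (h' i)))
    (hcenter : ∀ m, ∑ i, h m i * a m i = 0) :
    Tendsto (fun m : ℕ => ∑ i, (a m i : ℂ) *
        Complex.log (1 - ((s * h m i / √m + t / m : ℝ) : ℂ) * Complex.I)) atTop
      (𝓝 (-(t * Complex.I) + (s ^ 2 * ∑ i, f i * h' i ^ 2 : ℝ) / 2)) := by
  have hinv : Tendsto (fun m : ℕ => (√(m : ℝ))⁻¹) atTop (𝓝 0) :=
    tendsto_inv_atTop_zero.comp (Real.tendsto_sqrt_atTop.comp tendsto_natCast_atTop_atTop)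
  -- `v m i = √m u m i`, where `u m i` is the argument of the logarithm
  set v : ℕ → Fin n → ℝ := fun m i => s * h m i + t * (√(m : ℝ))⁻¹ with hv
  have hvlim : ∀ i, Tendsto (fun m => v m i) atTop (𝓝 (s * h' i)) := by
    intro i
    simpa using ((hh i).const_mul s).add (hinv.const_mul t)
  have huv : ∀ (m : ℕ) i, s * h m i / √m + t / m = v m i * (√(m : ℝ))⁻¹ := by
    intro m i
    rw [hv]
    have : (m : ℝ)⁻¹ = (√(m : ℝ))⁻¹ * (√(m : ℝ))⁻¹ := by
      rw [← mul_inv, Real.mul_self_sqrt m.cast_nonneg]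
    rw [div_eq_mul_inv, div_eq_mul_inv, this]
    ring
  have hulim : ∀ i, Tendsto (fun m : ℕ => s * h m i / √m + t / m) atTop (𝓝 0) := by
    intro i
    simp_rw [huv]
    simpa using (hvlim i).mul hinv
  have hlin : Tendsto (fun m : ℕ => ∑ i, a m i * (s * h m i / √m + t / m)) atTop (𝓝 t) := by
    have h1 : ∀ m : ℕ, ∑ i, a m i * (s * h m i / √m + t / m) = t * ∑ i, a m i / m := by
      intro m
      have h2 : ∀ i, a m i * (s * h m i / √m + t / m) =
          s / √m * (h m i * a m i) + t * (a m i / m) := fun i => by ring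
      simp_rw [h2]
      rw [Finset.sum_add_distrib, ← Finset.mul_sum, ← Finset.mul_sum, hcenter]
      ring
    simp_rw [h1]
    simpa [hf] using (tendsto_finsetSum Finset.univ fun i _ => haf i).const_mul t
  have hquad : Tendsto (fun m : ℕ => ∑ i, a m i * (s * h m i / √m + t / m) ^ 2) atTop
      (𝓝 (s ^ 2 * ∑ i, f i * h' i ^ 2)) := by
    have h1 : ∀ (m : ℕ) i, a m i * (s * h m i / √m + t / m) ^ 2 = a m i / m * v m i ^ 2 := by
      intro m i
      rw [huv, mul_pow, inv_pow, Real.sq_sqrt m.cast_nonneg]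
      ring
    simp_rw [h1, Finset.mul_sum]
    refine tendsto_finsetSum _ fun i _ => ?_
    convert (haf i).mul ((hvlim i).pow 2) using 2
    ring
  have hrem : Tendsto (fun m : ℕ => ∑ i, ((a m i : ℂ) *
        Complex.log (1 - ((s * h m i / √m + t / m : ℝ) : ℂ) * Complex.I)
        - a m i * (-(((s * h m i / √m + t / m : ℝ) : ℂ) * Complex.I)
          + ((s * h m i / √m + t / m : ℝ) : ℂ) ^ 2 / 2))) atTop (𝓝 0) := by
    rw [show (0 : ℂ) = ∑ _i : Fin n, 0 by simp]
    refine tendsto_finsetSum _ fun i _ => ?_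
    have hb : Tendsto (fun m : ℕ => a m i / m * |v m i| ^ 3 * (√(m : ℝ))⁻¹) atTop (𝓝 0) := by
      simpa using ((haf i).mul ((hvlim i).abs.pow 3)).mul hinv
    refine squeeze_zero_norm' ?_ hb
    have hsmall := (hulim i).abs.eventually_le_const (u := 1 / 2) (by norm_num)
    filter_upwards [hsmall] with m hm
    rw [← mul_sub, norm_mul, Complex.norm_real, Real.norm_of_nonneg (ha m i)]
    refine (mul_le_mul_of_nonneg_left (norm_log_one_sub_mul_I_le hm) (ha m i)).trans_eq ?_
    rw [huv, abs_mul, abs_of_nonneg (by positivity : 0 ≤ (√(m : ℝ))⁻¹), mul_pow]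
    have : (√(m : ℝ))⁻¹ ^ 3 = (m : ℝ)⁻¹ * (√(m : ℝ))⁻¹ := by
      rw [pow_succ, inv_pow, Real.sq_sqrt m.cast_nonneg]
    rw [this]
    ring
  have hmain := ((((Complex.continuous_ofReal.tendsto _).comp hlin).mul_const Complex.I).neg.add
    (((Complex.continuous_ofReal.tendsto _).comp hquad).div_const 2)).add hrem
  rw [add_zero] at hmain
  refine hmain.congr fun m => ?_
  simp only [Function.comp_apply, Complex.ofReal_sum, Finset.sum_sub_distrib]
  have h3 : ∑ i, (a m i : ℂ) * (-(((s * h m i / √m + t / m : ℝ) : ℂ) * Complex.I)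
      + ((s * h m i / √m + t / m : ℝ) : ℂ) ^ 2 / 2) =
      -((∑ i, ((a m i * (s * h m i / √m + t / m) : ℝ) : ℂ)) * Complex.I) +
        (∑ i, ((a m i * (s * h m i / √m + t / m) ^ 2 : ℝ) : ℂ)) / 2 := by
    rw [Finset.sum_mul, Finset.sum_div, ← Finset.sum_neg_distrib, ← Finset.sum_add_distrib]
    refine Finset.sum_congr rfl fun i _ => ?_
    push_cast
    ring
  rw [h3]
  ring

/-- The pair of the normalized fluctuation `∑ hᵢ Gᵢ / √m` and the normalized total mass `∑ Gᵢ / m` of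
independent gamma variables converges in distribution to `(N(0, V), 1)`. The pair is taken in the
Euclidean plane because Lévy's theorem needs an inner product. -/
theorem tendstoInDistribution_pi_gammaLaw {n : ℕ} {a h : ℕ → Fin n → ℝ} {f h' : Fin n → ℝ}
    {V : NNReal}
    (ha : ∀ m i, 0 ≤ a m i) (haf : ∀ i, Tendsto (fun m : ℕ => a m i / m) atTop (𝓝 (f i)))
    (hf : ∑ i, f i = 1) (hh : ∀ i, Tendsto (fun m => h m i) atTop (𝓝 (h' i)))
    (hcenter : ∀ m, ∑ i, h m i * a m i = 0) (hV : ∑ i, f i * h' i ^ 2 = V) :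
    TendstoInDistribution
      (fun (m : ℕ) (g : Fin n → ℝ) =>
        WithLp.toLp 2 ((∑ i, h m i * g i) / √m, (∑ i, g i) / m)) atTop
      (fun w => WithLp.toLp 2 w)
      (fun m => Measure.pi fun i => gammaLaw (a m i))
      ((gaussianReal 0 V).prod (Measure.dirac 1)) := by
  have hmeas : ∀ m : ℕ, Measurable (fun g : Fin n → ℝ =>
      WithLp.toLp 2 ((∑ i, h m i * g i) / √m, (∑ i, g i) / m)) := by
    intro m
    refine (WithLp.measurable_toLp 2 _).comp ?_
    fun_prop
  refine ⟨fun m => (hmeas m).aemeasurable, (WithLp.measurable_toLp 2 _).aemeasurable, ?_⟩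
  refine ProbabilityMeasure.tendsto_of_tendsto_charFun fun p => ?_
  simp only [ProbabilityMeasure.coe_mk]
  rw [charFun_prod, charFun_gaussianReal, charFun_dirac]
  have hm : ∀ m : ℕ, charFun (Measure.map (fun g : Fin n → ℝ =>
      WithLp.toLp 2 ((∑ i, h m i * g i) / √m, (∑ i, g i) / m))
        (Measure.pi fun i => gammaLaw (a m i))) p =
      Complex.exp (-∑ i, (a m i : ℂ) *
        Complex.log (1 - ((p.ofLp.1 * h m i / √m + p.ofLp.2 / m : ℝ) : ℂ) * Complex.I)) := by
    intro m
    rw [← integral_exp_pi_gammaLaw (ha m), charFun_apply,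
      integral_map (hmeas m).aemeasurable (by fun_prop)]
    congr with g
    congr 3
    simp only [WithLp.prod_inner_apply, Real.inner_apply]
    rw [Finset.sum_div, Finset.sum_div, Finset.sum_mul, Finset.sum_mul, ← Finset.sum_add_distrib]
    refine Finset.sum_congr rfl fun i _ => ?_
    ring
  simp_rw [hm]
  have hlim := (tendsto_sum_mul_log (s := p.ofLp.1) (t := p.ofLp.2) ha haf hf hh hcenter).neg
  have hexp := (Complex.continuous_exp.tendsto _).comp hlim
  refine (tendsto_congr fun m => rfl).mp (hexp.trans (le_of_eq (congrArg 𝓝 ?_)))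
  rw [← Complex.exp_add, hV]
  congr 1
  simp
  ring

/-! ### The central limit theorem for Dirichlet distributions -/

/-- The limit of the characteristic function of `√m ∑ θᵢ (Gᵢ / S - aᵢ / ∑ aⱼ)`, where `S = ∑ Gⱼ`.
With `c = ∑ θᵢ aᵢ / ∑ aⱼ` this variable is the quotient of `∑ (θᵢ - c) Gᵢ / √m` by `S / m`, so it
inherits the Gaussian limit of its numerator. -/
theorem tendsto_integral_exp_pi_gammaLaw {n : ℕ} {a : ℕ → Fin n → ℝ} {f : Fin n → ℝ}
    (ha : ∀ m i, 0 ≤ a m i) (ha0 : ∀ m, 0 < ∑ i, a m i)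
    (haf : ∀ i, Tendsto (fun m : ℕ => a m i / m) atTop (𝓝 (f i)))
    (hf : ∑ i, f i = 1) (θ : Fin n → ℝ) :
    Tendsto (fun m : ℕ => ∫ g, Complex.exp
        ((√m * (∑ i, θ i * (g i / ∑ j, g j) - (∑ i, θ i * a m i) / ∑ i, a m i) : ℝ) * Complex.I)
          ∂(Measure.pi fun i => gammaLaw (a m i))) atTop
      (𝓝 (Complex.exp (-((∑ i, f i * θ i ^ 2 - (∑ i, f i * θ i) ^ 2 : ℝ) : ℂ) / 2))) := by
  have hf0 : ∀ i, 0 ≤ f i := fun i =>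
    ge_of_tendsto' (haf i) fun m => div_nonneg (ha m i) m.cast_nonneg
  set c : ℕ → ℝ := fun m => (∑ i, θ i * a m i) / ∑ i, a m i with hc
  have hclim : Tendsto c atTop (𝓝 (∑ i, f i * θ i)) := by
    have h1 : Tendsto (fun m : ℕ => (∑ i, θ i * (a m i / m)) / ∑ i, a m i / m) atTop
        (𝓝 ((∑ i, θ i * f i) / ∑ i, f i)) := by
      refine Tendsto.div (tendsto_finsetSum _ fun i _ => (haf i).const_mul _)
        (tendsto_finsetSum _ fun i _ => haf i) ?_
      rw [hf]
      exact one_ne_zero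
    rw [hf, div_one] at h1
    simp_rw [mul_comm (f _)]
    refine h1.congr' ?_
    filter_upwards [eventually_gt_atTop 0] with m hm
    have hm' : (m : ℝ) ≠ 0 := by positivity
    simp_rw [← mul_div_assoc]
    rw [← Finset.sum_div, ← Finset.sum_div, div_div_div_cancel_right₀ hm']
  have hvar : ∑ i, f i * (θ i - ∑ j, f j * θ j) ^ 2 =
      ∑ i, f i * θ i ^ 2 - (∑ i, f i * θ i) ^ 2 := by
    set b := ∑ j, f j * θ j with hb
    have h1 : ∀ i, f i * (θ i - b) ^ 2 = f i * θ i ^ 2 - 2 * b * (f i * θ i) + b ^ 2 * f i :=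
      fun i => by ring
    simp_rw [h1]
    rw [Finset.sum_add_distrib, Finset.sum_sub_distrib, ← Finset.mul_sum, ← Finset.mul_sum, hf,
      ← hb]
    ring
  have hV0 : 0 ≤ ∑ i, f i * (θ i - ∑ j, f j * θ j) ^ 2 :=
    Finset.sum_nonneg fun i _ => mul_nonneg (hf0 i) (sq_nonneg _)
  obtain ⟨V, hV⟩ : ∃ V : NNReal, ∑ i, f i * (θ i - ∑ j, f j * θ j) ^ 2 = V := ⟨⟨_, hV0⟩, rfl⟩
  have hdist := tendstoInDistribution_pi_gammaLaw (a := a) (h := fun m i => θ i - c m)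
    (f := f) (h' := fun i => θ i - ∑ j, f j * θ j) (V := V) ha haf hf
    (fun i => hclim.const_sub _) (fun m => by
      simp_rw [sub_mul]
      rw [Finset.sum_sub_distrib, ← Finset.mul_sum, hc]
      simp only
      rw [div_mul_cancel₀ _ (ha0 m).ne', sub_self]) hV
  have hconv := hdist.tendsto
  -- `w / r` is not continuous at `r = 0`. It is replaced by `w / max r (1 / 2)`; the error is at most
  -- `2 ψ(r)` for a continuous `ψ` that is `1` for `r ≤ 1 / 2` and vanishes at the limit `r = 1`.
  let G : BoundedContinuousFunction (WithLp 2 (ℝ × ℝ)) ℂ :=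
    BoundedContinuousFunction.ofNormedAddCommGroup
      (fun p => Complex.exp ((p.ofLp.1 / max p.ofLp.2 (1 / 2) : ℝ) * Complex.I))
      (by
        refine Complex.continuous_exp.comp ((Complex.continuous_ofReal.comp ?_).mul
          continuous_const)
        refine Continuous.div (by fun_prop) (by fun_prop) fun p => ?_
        have : (1 / 2 : ℝ) ≤ max p.ofLp.2 (1 / 2) := le_max_right _ _
        positivity)
      1 (fun p => (Complex.norm_exp_ofReal_mul_I _).le)
  let ψ : BoundedContinuousFunction (WithLp 2 (ℝ × ℝ)) ℝ :=
    BoundedContinuousFunction.ofNormedAddCommGroup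
      (fun p => max 0 (min 1 (3 - 4 * p.ofLp.2))) (by fun_prop) 1 (fun p => by
        rw [Real.norm_of_nonneg (le_max_left _ _)]
        exact max_le zero_le_one (min_le_left _ _))
  have hmeas := hdist.forall_aemeasurable
  have hG := (ProbabilityMeasure.tendsto_iff_forall_integral_rclike_tendsto ℂ).1 hconv G
  have hψ := (ProbabilityMeasure.tendsto_iff_forall_integral_tendsto).1 hconv ψ
  simp only [ProbabilityMeasure.coe_mk] at hG hψ
  rw [integral_map hdist.aemeasurable_limit (by fun_prop)] at hG hψ
  simp_rw [fun m => integral_map (hmeas m) (G.continuous.aestronglyMeasurable)] at hG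
  simp_rw [fun m => integral_map (hmeas m) (ψ.continuous.aestronglyMeasurable)] at hψ
  have hψ0 : ∫ w, ψ (WithLp.toLp 2 w) ∂((gaussianReal 0 V).prod (Measure.dirac (1 : ℝ))) = 0 := by
    rw [integral_prod (fun w => ψ (WithLp.toLp 2 w))
      ((ψ.integrable _).comp_aemeasurable hdist.aemeasurable_limit)]
    simp only [integral_dirac]
    simp [ψ]
    norm_num
  have hG0 : ∫ w, G (WithLp.toLp 2 w) ∂((gaussianReal 0 V).prod (Measure.dirac (1 : ℝ))) =
      Complex.exp (-((∑ i, f i * θ i ^ 2 - (∑ i, f i * θ i) ^ 2 : ℝ) : ℂ) / 2) := by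
    rw [integral_prod (fun w => G (WithLp.toLp 2 w))
      ((G.integrable _).comp_aemeasurable hdist.aemeasurable_limit)]
    simp only [integral_dirac]
    have h1 : ∀ x : ℝ, G (WithLp.toLp 2 (x, 1)) = Complex.exp ((1 : ℝ) * x * Complex.I) := by
      intro x
      have : max (1 : ℝ) 2⁻¹ = 1 := by norm_num
      simp [G, this]
    simp_rw [h1]
    rw [← charFun_apply_real, charFun_gaussianReal, ← hvar, hV]
    congr 1
    simp
    ring
  rw [hψ0] at hψ
  rw [hG0] at hG
  refine hG.congr_dist ?_
  refine squeeze_zero' (Eventually.of_forall fun _ => dist_nonneg) ?_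
    (by simpa using hψ.const_mul 2)
  filter_upwards [eventually_gt_atTop 0] with m hm
  have hm' : (0 : ℝ) < m := by exact_mod_cast hm
  rw [dist_eq_norm, ← integral_sub]
  · rw [← integral_const_mul]
    refine norm_integral_le_of_norm_le ?_ (ae_of_all _ fun g => ?_)
    · exact ((ψ.integrable _).comp_aemeasurable (hmeas m)).const_mul 2
    · by_cases hS : (∑ i, g i) / m < 1 / 2
      · have : ψ (WithLp.toLp 2 ((∑ i, (θ i - c m) * g i) / √m, (∑ i, g i) / m)) = 1 := by
          change max 0 (min 1 (3 - 4 * ((∑ i, g i) / m))) = 1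
          rw [min_eq_left (by linarith), max_eq_right zero_le_one]
        rw [this]
        refine (norm_sub_le _ _).trans ?_
        rw [Complex.norm_exp_ofReal_mul_I]
        have h2 : ‖G (WithLp.toLp 2 ((∑ i, (θ i - c m) * g i) / √m, (∑ i, g i) / m))‖ = 1 :=
          Complex.norm_exp_ofReal_mul_I _
        rw [h2]
        norm_num
      · rw [not_lt] at hS
        have hS0 : (∑ i, g i) ≠ 0 := by
          intro h0
          rw [h0, zero_div] at hS
          norm_num at hS
        have heq : (∑ i, (θ i - c m) * g i) / √m / max ((∑ i, g i) / m) (1 / 2) =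
            √m * (∑ i, θ i * (g i / ∑ j, g j) - c m) := by
          rw [max_eq_left hS]
          have h3 : ∑ i, θ i * (g i / ∑ j, g j) = (∑ i, θ i * g i) / ∑ j, g j := by
            rw [Finset.sum_div]
            exact Finset.sum_congr rfl fun i _ => by ring
          simp_rw [sub_mul]
          rw [Finset.sum_sub_distrib, ← Finset.mul_sum, h3]
          have hsq : √(m : ℝ) ≠ 0 := (Real.sqrt_pos.2 hm').ne'
          have hsq2 : (m : ℝ) = √m * √m := (Real.mul_self_sqrt hm'.le).symm
          field_simp
          rw [Real.sq_sqrt hm'.le]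
        have h4 : G (WithLp.toLp 2 ((∑ i, (θ i - c m) * g i) / √m, (∑ i, g i) / m)) =
            Complex.exp ((√m * (∑ i, θ i * (g i / ∑ j, g j) - c m) : ℝ) * Complex.I) := by
          rw [← heq]
          rfl
        rw [h4, sub_self, norm_zero]
        exact mul_nonneg zero_le_two (le_max_left _ _)
  · exact (G.integrable _).comp_aemeasurable (hmeas m)
  · refine Integrable.of_bound (Measurable.aestronglyMeasurable (by fun_prop)) 1
      (ae_of_all _ fun g => ?_)
    exact (Complex.norm_exp_ofReal_mul_I _).le

/-- If `a m i / m → f i`, the Dirichlet vector with parameters `a m`, centered at its mean and scaled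
by `√m`, has the limiting covariance `diag f - f fᵀ` of a multinomial vector. -/
theorem tendsto_integral_exp_dirichletMeasure {n : ℕ} {a : ℕ → Fin n → ℝ} {f : Fin n → ℝ}
    (ha : ∀ m i, 0 ≤ a m i) (ha0 : ∀ m, 0 < ∑ i, a m i)
    (haf : ∀ i, Tendsto (fun m : ℕ => a m i / m) atTop (𝓝 (f i)))
    (hf : ∑ i, f i = 1) (θ : Fin n → ℝ) :
    Tendsto (fun m : ℕ => ∫ y, Complex.exp
        ((√m * ∑ i, θ i * (y i - a m i / ∑ j, a m j) : ℝ) * Complex.I)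
          ∂(dirichletMeasure (a m))) atTop
      (𝓝 (Complex.exp (-((∑ i, f i * θ i ^ 2 - (∑ i, f i * θ i) ^ 2 : ℝ) : ℂ) / 2))) := by
  refine (tendsto_integral_exp_pi_gammaLaw ha ha0 haf hf θ).congr fun m => ?_
  rw [dirichletMeasure, integral_map (Measurable.aemeasurable (by fun_prop))
    (Measurable.aestronglyMeasurable (by fun_prop))]
  congr with g
  congr 4
  simp_rw [mul_sub]
  rw [Finset.sum_sub_distrib, Finset.sum_div]
  simp_rw [mul_div_assoc]

/-! ### Convergence in distribution of random vectors -/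

/-- Lévy's convergence theorem for `Fin k → ℝ`, which carries no inner product. The variables may
live on different probability spaces. -/
theorem tendstoInDistribution_pi_of_tendsto_integral_exp {k : ℕ} {Ω : ℕ → Type*} {Ω' : Type*}
    {mΩ : ∀ m, MeasurableSpace (Ω m)} {mΩ' : MeasurableSpace Ω'}
    {μ : ∀ m, Measure (Ω m)} [∀ m, IsProbabilityMeasure (μ m)]
    {ν : Measure Ω'} [IsProbabilityMeasure ν]
    {Y : ∀ m, Ω m → Fin k → ℝ} {Z : Ω' → Fin k → ℝ}
    (hY : ∀ m, AEMeasurable (Y m) (μ m)) (hZ : AEMeasurable Z ν)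
    (h : ∀ t : Fin k → ℝ, Tendsto
      (fun m => ∫ ω, Complex.exp ((∑ j, t j * Y m ω j : ℝ) * Complex.I) ∂(μ m)) atTop
      (𝓝 (∫ ω, Complex.exp ((∑ j, t j * Z ω j : ℝ) * Complex.I) ∂ν))) :
    TendstoInDistribution Y atTop Z μ ν := by
  have hY' : ∀ m, AEMeasurable (fun ω => WithLp.toLp 2 (Y m ω)) (μ m) := fun m =>
    (WithLp.measurable_toLp 2 _).comp_aemeasurable (hY m)
  have hZ' : AEMeasurable (fun ω => WithLp.toLp 2 (Z ω)) ν :=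
    (WithLp.measurable_toLp 2 _).comp_aemeasurable hZ
  have hE : TendstoInDistribution (fun m ω => WithLp.toLp 2 (Y m ω)) atTop
      (fun ω => WithLp.toLp 2 (Z ω)) μ ν := by
    refine ⟨hY', hZ', ProbabilityMeasure.tendsto_of_tendsto_charFun fun t => ?_⟩
    simp only [ProbabilityMeasure.coe_mk, charFun_apply]
    rw [integral_map hZ' (by fun_prop)]
    simp_rw [fun m => integral_map (hY' m)
      (f := fun x => Complex.exp ((inner ℝ x t : ℝ) * Complex.I))
      (by fun_prop)]
    simpa [PiLp.inner_apply] using h t.ofLp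
  exact hE.continuous_comp (g := WithLp.ofLp) (by fun_prop)

/-! ### The posterior base distribution and the Brownian bridge on a partition -/

/-- Finitely many measurable sets are unions of fibres of one measurable map `c` to a finite set. The
target has at least two points, so that the fibres of `c` (some possibly empty) form a partition of
the kind that `IsDirichletProcess` refers to, even for `k = 0`. -/
theorem exists_measurable_fin_preimage {𝒳 : Type*} [MeasurableSpace 𝒳] {k : ℕ}
    (A : Fin k → {A : Set 𝒳 // MeasurableSet A}) :
    ∃ n, 2 ≤ n ∧ ∃ c : 𝒳 → Fin n, Measurable c ∧
      ∃ T : Fin k → Finset (Fin n), ∀ j, (A j).1 = c ⁻¹' T j := by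
  classical
  let e : (Fin k → Bool) ≃ Fin (Fintype.card (Fin k → Bool)) := Fintype.equivFin _
  have h1 : 1 ≤ Fintype.card (Fin k → Bool) := Fintype.card_pos
  let pat : 𝒳 → Fin k → Bool := fun x j => decide (x ∈ (A j).1)
  have hpat : Measurable pat := by
    refine measurable_pi_lambda _ fun j => measurable_to_bool ?_
    convert (A j).2 using 1
    ext x
    simp [pat]
  -- A point is labelled by its membership pattern; the last label is never used.
  refine ⟨Fintype.card (Fin k → Bool) + 1, by omega, fun x => (e (pat x)).castSucc,
    (measurable_of_finite (fun s => (e s).castSucc)).comp hpat,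
    fun j => Finset.univ.filter fun i => ∃ s : Fin k → Bool, s j = true ∧ (e s).castSucc = i,
    fun j => ?_⟩
  ext x
  simp only [Finset.coe_filter, Finset.mem_univ, true_and, Set.mem_preimage, Set.mem_ofPred_eq,
    Fin.castSucc_inj, e.apply_eq_iff_eq, exists_eq_right]
  simp [pat]

theorem empiricalMeasure_real {𝒳 : Type*} [MeasurableSpace 𝒳] {m : ℕ} (x : Fin m → 𝒳) {A : Set 𝒳}
    (hA : MeasurableSet A) :
    (empiricalMeasure x).real A = (∑ i, A.indicator 1 (x i)) / m := by
  simp only [empiricalMeasure, measureReal_ennreal_smul_apply, ENNReal.toReal_inv,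
    ENNReal.toReal_natCast]
  rw [div_eq_inv_mul]
  congr 1
  rw [measureReal_def, Measure.finsetSum_apply, ENNReal.toReal_sum (by simp)]
  refine Finset.sum_congr rfl fun i _ => ?_
  rw [Measure.dirac_apply' _ hA]
  by_cases h : x i ∈ A <;> simp [h]

/-- For `m = 0` the empirical measure is `∞ • 0 = 0`, and the formula still holds. -/
theorem posteriorBase_real {𝒳 : Type*} [MeasurableSpace 𝒳] {α : ℝ} (hα : 0 < α) (H : Measure 𝒳)
    [IsFiniteMeasure H] {m : ℕ} (x : Fin m → 𝒳) {A : Set 𝒳} (hA : MeasurableSet A) :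
    (posteriorBase α H x).real A = (α * H.real A + ∑ i, A.indicator 1 (x i)) / (α + m) := by
  have hpos : 0 < α + m := by positivity
  have h2 : (ENNReal.ofReal (m / (α + m)) • empiricalMeasure x) A ≠ ∞ := by
    rcases Nat.eq_zero_or_pos m with rfl | hm
    · simp
    · simp only [Measure.smul_apply, empiricalMeasure, smul_eq_mul, Measure.finsetSum_apply]
      refine ENNReal.mul_ne_top ENNReal.ofReal_ne_top (ENNReal.mul_ne_top ?_ ?_)
      · simp [hm.ne']
      · exact ENNReal.sum_ne_top.2 fun i _ => measure_ne_top _ _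
  have h1 : (ENNReal.ofReal (α / (α + m)) • H) A ≠ ∞ := by
    rw [Measure.smul_apply, smul_eq_mul]
    finiteness
  rw [posteriorBase, measureReal_add_apply h1 h2, measureReal_ennreal_smul_apply,
    measureReal_ennreal_smul_apply, ENNReal.toReal_ofReal (by positivity),
    ENNReal.toReal_ofReal (by positivity), empiricalMeasure_real x hA]
  rcases Nat.eq_zero_or_pos m with rfl | hm
  · simp; ring
  · have : (m : ℝ) ≠ 0 := by positivity
    field_simp

theorem IsBrownianBridge.integral_exp {Ω 𝒳 : Type*} [MeasurableSpace Ω] [MeasurableSpace 𝒳]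
    {B : {A : Set 𝒳 // MeasurableSet A} → Ω → ℝ} {F : Measure 𝒳} {ν : Measure Ω}
    (hB : IsBrownianBridge B F ν) {k : ℕ}
    (A : Fin k → {A : Set 𝒳 // MeasurableSet A}) (t : Fin k → ℝ) :
    ∫ ω, Complex.exp ((∑ j, t j * B (A j) ω : ℝ) * Complex.I) ∂ν =
      Complex.exp (-((∑ j, ∑ l, t j * t l *
        (F.real ((A j).1 ∩ (A l).1) - F.real (A j).1 * F.real (A l).1) : ℝ) : ℂ) / 2) := by
  have hmem : ∀ a, MemLp (B a) 2 ν := fun a => (hB.isGaussianProcess.hasGaussianLaw_eval a).memLp_two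
  have hG : HasGaussianLaw (fun ω => ∑ j, t j * B (A j) ω) ν :=
    ((hB.isGaussianProcess.comp_right A).smul t).hasGaussianLaw_fun_sum (I := Finset.univ)
  have := hB.isGaussianProcess.isProbabilityMeasure
  have hmean : ∫ ω, ∑ j, t j * B (A j) ω ∂ν = 0 := by
    rw [integral_finsetSum _ fun j _ => ((hmem (A j)).integrable (by norm_num)).const_mul _]
    simp [integral_const_mul, hB.integral_eq_zero]
  have hvar : Var[fun ω => ∑ j, t j * B (A j) ω; ν] = ∑ j, ∑ l, t j * t l *
      (F.real ((A j).1 ∩ (A l).1) - F.real (A j).1 * F.real (A l).1) := by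
    rw [← covariance_self hG.aemeasurable,
      covariance_fun_sum_fun_sum (fun j => (hmem (A j)).const_mul (t j))
        (fun j => (hmem (A j)).const_mul (t j))]
    simp_rw [covariance_const_mul_left, covariance_const_mul_right, hB.covariance_eq]
    simp_rw [mul_assoc]
  have h := hG.charFun_map_eq 1
  rw [charFun_apply_real, integral_map hG.aemeasurable (by fun_prop)] at h
  simp only [Real.inner_apply, one_mul, hmean, hvar, Complex.ofReal_one] at h
  rw [h]
  congr 1
  simp
  ring

theorem isProbabilityMeasure_posteriorBase {𝒳 : Type*} [MeasurableSpace 𝒳] {α : ℝ} (hα : 0 < α)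
    (H : Measure 𝒳) [IsProbabilityMeasure H] {m : ℕ} (x : Fin m → 𝒳) :
    IsProbabilityMeasure (posteriorBase α H x) := by
  constructor
  rw [← ENNReal.toReal_eq_one_iff, ← measureReal_def, posteriorBase_real hα H x MeasurableSet.univ]
  simp only [probReal_univ, mul_one, Set.indicator_univ, Pi.one_apply, Finset.sum_const,
    Finset.card_univ, Fintype.card_fin, nsmul_eq_mul]
  exact div_self (by positivity)

theorem measureReal_preimage_eq_sum {𝒳 : Type*} [MeasurableSpace 𝒳] {n : ℕ} {c : 𝒳 → Fin n}
    (hc : Measurable c) (T : Finset (Fin n)) (p : Measure 𝒳) [IsFiniteMeasure p] :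
    p.real (c ⁻¹' T) = ∑ i, (if i ∈ T then 1 else 0) * p.real (c ⁻¹' {i}) := by
  rw [← sum_measureReal_preimage_singleton T fun i _ => hc (measurableSet_singleton i)]
  simp [Finset.sum_ite_mem]

/-! ### Conditional and unconditional limits -/

/-- The conditional limit along one deterministic sample sequence `x` whose frequencies in the cells
of a partition converge to their `F`-probabilities: the posterior probabilities of the cells are a
Dirichlet vector with parameters `α H(Cᵢ) + #{l < m | x l ∈ Cᵢ}`, and `α H(Cᵢ)` is negligible
relative to `m`. -/
theorem tendsto_integral_exp_posteriorDeviation {𝒳 : Type*} [MeasurableSpace 𝒳]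
    {α : ℝ} (hα : 0 < α) (H : Measure 𝒳) [IsProbabilityMeasure H]
    (F : Measure 𝒳) [IsProbabilityMeasure F] (x : ℕ → 𝒳)
    {q : ℕ → Measure (Measure 𝒳)}
    (hq : ∀ m : ℕ, IsDirichletProcess (fun p : Measure 𝒳 => p) (α + (m : ℝ))
      (posteriorBase α H fun i : Fin m => x i) (q m))
    {n : ℕ} (hn : 2 ≤ n) {c : 𝒳 → Fin n} (hc : Measurable c)
    (hx : ∀ i, Tendsto
      (fun m : ℕ => (∑ l ∈ Finset.range m, (c ⁻¹' {i}).indicator (1 : 𝒳 → ℝ) (x l)) / m) atTop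
      (𝓝 (F.real (c ⁻¹' {i}))))
    {k : ℕ} (T : Fin k → Finset (Fin n)) (t : Fin k → ℝ) :
    Tendsto (fun m : ℕ => ∫ p, Complex.exp ((∑ j, t j *
        posteriorDeviation α H (fun i : Fin m => x i) p (c ⁻¹' T j) : ℝ) * Complex.I) ∂(q m)) atTop
      (𝓝 (Complex.exp (-((∑ j, ∑ l, t j * t l * (F.real (c ⁻¹' T j ∩ c ⁻¹' T l)
        - F.real (c ⁻¹' T j) * F.real (c ⁻¹' T l)) : ℝ) : ℂ) / 2))) := by
  have hC : ∀ i, MeasurableSet (c ⁻¹' {i}) := fun i => hc (measurableSet_singleton i)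
  set base : ∀ m : ℕ, Measure 𝒳 := fun m => posteriorBase α H fun i : Fin m => x i with hbase
  have hprob : ∀ m, IsProbabilityMeasure (base m) := fun m =>
    isProbabilityMeasure_posteriorBase hα H _
  have hcells : ∀ (p : Measure 𝒳) [IsProbabilityMeasure p], ∑ i, p.real (c ⁻¹' {i}) = 1 := by
    intro p _
    rw [sum_measureReal_preimage_singleton Finset.univ fun i _ => hC i]
    simp
  set a : ℕ → Fin n → ℝ := fun m i => (α + m) * (base m).real (c ⁻¹' {i}) with ha
  have hpos : ∀ m : ℕ, 0 < α + m := fun m => by positivity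
  have hsum : ∀ m, ∑ i, a m i = α + m := by
    intro m
    rw [ha, ← Finset.mul_sum, hcells, mul_one]
  -- `∑ t j 1_{A j}` takes the value `θ i` on the cell `i`
  set θ : Fin n → ℝ := fun i => ∑ j, t j * (if i ∈ T j then 1 else 0) with hθ
  have hlin : ∀ (p : Measure 𝒳) [IsProbabilityMeasure p],
      ∑ j, t j * p.real (c ⁻¹' T j) = ∑ i, θ i * p.real (c ⁻¹' {i}) := by
    intro p _
    simp_rw [measureReal_preimage_eq_sum hc, hθ, Finset.mul_sum, Finset.sum_mul]
    rw [Finset.sum_comm]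
    simp_rw [mul_assoc]
  have haf : ∀ i, Tendsto (fun m : ℕ => a m i / m) atTop (𝓝 (F.real (c ⁻¹' {i}))) := by
    intro i
    have h1 : ∀ m : ℕ, a m i / m = α * H.real (c ⁻¹' {i}) / m +
        (∑ l ∈ Finset.range m, (c ⁻¹' {i}).indicator (1 : 𝒳 → ℝ) (x l)) / m := by
      intro m
      rw [ha, hbase]
      simp only
      rw [posteriorBase_real hα H _ (hC i), mul_div_cancel₀ _ (hpos m).ne', add_div,
        ← Fin.sum_univ_eq_sum_range (fun l => (c ⁻¹' {i}).indicator (1 : 𝒳 → ℝ) (x l))]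
    simp_rw [h1]
    simpa using (tendsto_const_div_atTop_nhds_zero_nat (α * H.real (c ⁻¹' {i}))).add (hx i)
  have hmain := tendsto_integral_exp_dirichletMeasure (a := a)
    (f := fun i => F.real (c ⁻¹' {i}))
    (fun m i => mul_nonneg (hpos m).le measureReal_nonneg) (fun m => by rw [hsum]; exact hpos m)
    haf (hcells F) θ
  have hvar : ∑ i, F.real (c ⁻¹' {i}) * θ i ^ 2 - (∑ i, F.real (c ⁻¹' {i}) * θ i) ^ 2 =
      ∑ j, ∑ l, t j * t l * (F.real (c ⁻¹' T j ∩ c ⁻¹' T l)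
        - F.real (c ⁻¹' T j) * F.real (c ⁻¹' T l)) := by
    have h1 : ∑ i, F.real (c ⁻¹' {i}) * θ i = ∑ j, t j * F.real (c ⁻¹' T j) := by
      rw [hlin]
      exact Finset.sum_congr rfl fun i _ => mul_comm _ _
    have h2 : ∀ j l, F.real (c ⁻¹' T j ∩ c ⁻¹' T l) = ∑ i,
        (if i ∈ T j then 1 else 0) * (if i ∈ T l then 1 else 0) * F.real (c ⁻¹' {i}) := by
      intro j l
      rw [← Set.preimage_inter, ← Finset.coe_inter, measureReal_preimage_eq_sum hc]
      refine Finset.sum_congr rfl fun i _ => ?_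
      by_cases hj : i ∈ T j <;> by_cases hl : i ∈ T l <;> simp [hj, hl]
    have h3 : ∑ i, F.real (c ⁻¹' {i}) * θ i ^ 2 =
        ∑ j, ∑ l, t j * t l * F.real (c ⁻¹' T j ∩ c ⁻¹' T l) := by
      simp_rw [h2, hθ, sq, Finset.sum_mul_sum, Finset.mul_sum]
      rw [Finset.sum_comm]
      refine Finset.sum_congr rfl fun j _ => ?_
      rw [Finset.sum_comm]
      refine Finset.sum_congr rfl fun l _ => Finset.sum_congr rfl fun i _ => ?_
      ring
    rw [h1, h3, sq, Finset.sum_mul_sum, ← Finset.sum_sub_distrib]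
    refine Finset.sum_congr rfl fun j _ => ?_
    rw [← Finset.sum_sub_distrib]
    refine Finset.sum_congr rfl fun l _ => ?_
    ring
  rw [hvar] at hmain
  refine hmain.congr fun m => ?_
  have hmeasC : Measurable fun (p : Measure 𝒳) (i : Fin n) => p.real (c ⁻¹' {i}) :=
    measurable_pi_lambda _ fun i => (Measure.measurable_coe (hC i)).ennreal_toReal
  have hdir := (hq m).map_eq n (fun i => c ⁻¹' {i}) hn hC
    (fun i j hij => Disjoint.preimage c (by simpa using hij))
    (by rw [← Set.preimage_iUnion, Set.iUnion_of_singleton, Set.preimage_univ])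
  rw [ha, ← hdir, integral_map hmeasC.aemeasurable
    (Measurable.aestronglyMeasurable (by fun_prop))]
  refine integral_congr_ae ?_
  filter_upwards [(hq m).isProbabilityMeasure] with p hp
  have h4 : ∀ i, (α + m) * (base m).real (c ⁻¹' {i}) /
      ∑ j, (α + m) * (base m).real (c ⁻¹' {j}) = (base m).real (c ⁻¹' {i}) := by
    intro i
    rw [← Finset.mul_sum, hcells, mul_one, mul_div_cancel_left₀ _ (hpos m).ne']
  have h5 : ∑ j, t j * posteriorDeviation α H (fun i : Fin m => x i) p (c ⁻¹' T j) =
      √m * ∑ i, θ i * (p.real (c ⁻¹' {i}) - (base m).real (c ⁻¹' {i})) := by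
    simp_rw [mul_sub (θ _), Finset.sum_sub_distrib, ← hlin, ← Finset.sum_sub_distrib,
      Finset.mul_sum, posteriorDeviation]
    refine Finset.sum_congr rfl fun j _ => ?_
    ring
  simp only [h4, h5]

theorem ae_tendsto_frequency {Ω 𝒳 : Type*} [MeasurableSpace Ω] [MeasurableSpace 𝒳]
    {μ : Measure Ω} {F : Measure 𝒳} [IsFiniteMeasure F] {X : ℕ → Ω → 𝒳}
    (hX : iIndepFun X μ) (hXF : ∀ i, HasLaw (X i) F μ) {C : Set 𝒳} (hC : MeasurableSet C) :
    ∀ᵐ ω ∂μ, Tendsto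
      (fun m : ℕ => (∑ l ∈ Finset.range m, C.indicator (1 : 𝒳 → ℝ) (X l ω)) / m) atTop
      (𝓝 (F.real C)) := by
  have hind : Measurable (C.indicator (1 : 𝒳 → ℝ)) := measurable_one.indicator hC
  have h := strong_law_ae_real (μ := μ) (fun i ω => C.indicator (1 : 𝒳 → ℝ) (X i ω)) ?_ ?_ ?_
  · convert h using 5
    exact (integral_indicator_one hC).symm.trans
      ((hXF 0).integral_comp (f := C.indicator (1 : 𝒳 → ℝ)) hind.aestronglyMeasurable).symm
  · have hi : Integrable (C.indicator (1 : 𝒳 → ℝ)) (μ.map (X 0)) := by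
      rw [(hXF 0).map_eq]
      exact (integrable_indicator_iff hC).2 (integrable_const (1 : ℝ)).integrableOn
    exact hi.comp_aemeasurable (hXF 0).aemeasurable
  · intro i j hij
    exact (hX.indepFun hij).comp hind hind
  · intro i
    exact ((hXF i).identDistrib (hXF 0)).comp hind

theorem measurable_posteriorDeviation {𝒳 : Type*} [MeasurableSpace 𝒳] {α : ℝ} (hα : 0 < α)
    (H : Measure 𝒳) [IsFiniteMeasure H] {m : ℕ} {A : Set 𝒳} (hA : MeasurableSet A) :
    Measurable fun z : (Fin m → 𝒳) × Measure 𝒳 => posteriorDeviation α H z.1 z.2 A := by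
  simp only [posteriorDeviation]
  simp_rw [posteriorBase_real hα H _ hA]
  have h1 : Measurable fun z : (Fin m → 𝒳) × Measure 𝒳 => z.2.real A :=
    ((Measure.measurable_coe hA).comp measurable_snd).ennreal_toReal
  have h2 : Measurable fun z : (Fin m → 𝒳) × Measure 𝒳 =>
      ∑ i, A.indicator (1 : 𝒳 → ℝ) (z.1 i) :=
    Finset.measurable_sum _ fun i _ =>
      (measurable_one.indicator hA).comp ((measurable_pi_apply i).comp measurable_fst)
  exact (h1.sub ((h2.const_add _).div_const _)).const_mul _

theorem lemma2 {Ω Ω' 𝒳 : Type*} [MeasurableSpace Ω] [MeasurableSpace Ω'] [MeasurableSpace 𝒳]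
    (μ : Measure Ω) [IsProbabilityMeasure μ] (ν : Measure Ω') [IsProbabilityMeasure ν]
    -- the prior is `DP(α H)`
    (α : ℝ) (hα : 0 < α) (H : Measure 𝒳) [IsProbabilityMeasure H]
    -- `X₀, X₁, …` is an i.i.d. sequence with law `F`
    (F : Measure 𝒳) [IsProbabilityMeasure F] (X : ℕ → Ω → 𝒳)
    (hX : iIndepFun X μ) (hXF : ∀ i, HasLaw (X i) F μ)
    -- `Q m` is the posterior given a sample of size `m`
    (Q : ∀ m : ℕ, Kernel (Fin m → 𝒳) (Measure 𝒳)) [∀ m, IsMarkovKernel (Q m)]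
    (hQ : ∀ m, IsDirichletPosterior α H (Q m))
    -- `P m` is a random measure whose conditional law given the first `m` observations is `Q m`
    (P : ℕ → Ω → Measure 𝒳)
    (hP : ∀ m, HasCondDistrib (P m) (fun ω (i : Fin m) => X i ω) (Q m) μ)
    -- `B` is an `F`-Brownian bridge
    (B : {A : Set 𝒳 // MeasurableSet A} → Ω' → ℝ) (hB : IsBrownianBridge B F ν)
    -- the finite-dimensional distributions at `A₁, …, A_k`
    (k : ℕ) (A : Fin k → {A : Set 𝒳 // MeasurableSet A}) :
    -- conditionally on almost every sample sequence
    (∀ᵐ ω ∂μ, TendstoInDistribution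
      (fun (m : ℕ) (p : Measure 𝒳) (j : Fin k) =>
        posteriorDeviation α H (fun i : Fin m => X i ω) p (A j).1)
      atTop (fun ω' j => B (A j) ω') (fun m => Q m (fun i : Fin m => X i ω)) ν) ∧
    -- and unconditionally
    TendstoInDistribution
      (fun (m : ℕ) (ω : Ω) (j : Fin k) =>
        posteriorDeviation α H (fun i : Fin m => X i ω) (P m ω) (A j).1)
      atTop (fun ω' j => B (A j) ω') (fun _ => μ) ν := by
  obtain ⟨n, hn, c, hc, T, hT⟩ := exists_measurable_fin_preimage A
  have hBmeas : AEMeasurable (fun ω' (j : Fin k) => B (A j) ω') ν :=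
    aemeasurable_pi_lambda _ fun j => hB.isGaussianProcess.aemeasurable (A j)
  have hdev : ∀ m, Measurable fun (z : (Fin m → 𝒳) × Measure 𝒳) (j : Fin k) =>
      posteriorDeviation α H z.1 z.2 (A j).1 := fun m =>
    measurable_pi_lambda _ fun j => measurable_posteriorDeviation hα H (A j).2
  have hcond : ∀ᵐ ω ∂μ, ∀ t : Fin k → ℝ, Tendsto
      (fun m : ℕ => ∫ p, Complex.exp ((∑ j, t j *
        posteriorDeviation α H (fun i : Fin m => X i ω) p (A j).1 : ℝ) * Complex.I)
          ∂(Q m fun i : Fin m => X i ω)) atTop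
      (𝓝 (∫ ω', Complex.exp ((∑ j, t j * B (A j) ω' : ℝ) * Complex.I) ∂ν)) := by
    have hfreq := ae_all_iff.2 fun i : Fin n =>
      ae_tendsto_frequency hX hXF (hc (measurableSet_singleton i))
    filter_upwards [hfreq] with ω hω t
    rw [hB.integral_exp]
    simp_rw [hT]
    exact tendsto_integral_exp_posteriorDeviation hα H F (fun l => X l ω)
      (fun m => hQ m _) hn hc hω T t
  refine ⟨?_, ?_⟩
  · filter_upwards [hcond] with ω hω
    exact tendstoInDistribution_pi_of_tendsto_integral_exp
      (fun m => ((hdev m).comp (measurable_const.prodMk measurable_id)).aemeasurable) hBmeas hω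
  · refine tendstoInDistribution_pi_of_tendsto_integral_exp
      (fun m => (hdev m).comp_aemeasurable (hP m).aemeasurable) hBmeas fun t => ?_
    set φ : ∀ m, (Fin m → 𝒳) × Measure 𝒳 → ℂ := fun m z => Complex.exp ((∑ j, t j *
      posteriorDeviation α H z.1 z.2 (A j).1 : ℝ) * Complex.I) with hφ
    have hφm : ∀ m, Measurable (φ m) := by
      intro m
      have : Measurable fun y : Fin k → ℝ =>
        Complex.exp ((∑ j, t j * y j : ℝ) * Complex.I) := by fun_prop
      exact this.comp (hdev m)
    have hφ1 : ∀ m z, ‖φ m z‖ = 1 := fun m z => Complex.norm_exp_ofReal_mul_I _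
    have hXm : ∀ m : ℕ, AEMeasurable (fun ω (i : Fin m) => X i ω) μ := fun m =>
      (hP m).aemeasurable_fst
    have hinner : ∀ m, StronglyMeasurable fun x => ∫ p, φ m (x, p) ∂(Q m x) := fun m =>
      (hφm m).stronglyMeasurable.integral_kernel_prod_right'
    -- The unconditional characteristic function is the mean of the conditional ones, which are bounded
    -- by `1` and converge almost surely to a deterministic limit.
    have htower : ∀ m, ∫ ω, φ m (fun i : Fin m => X i ω, P m ω) ∂μ =
        ∫ ω, ∫ p, φ m (fun i : Fin m => X i ω, p) ∂(Q m fun i : Fin m => X i ω) ∂μ := by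
      intro m
      have hprob : IsProbabilityMeasure (μ.map fun ω (i : Fin m) => X i ω) :=
        Measure.isProbabilityMeasure_map (hXm m)
      refine ((hP m).integral_comp (f := φ m) (hφm m).aestronglyMeasurable).trans ?_
      rw [Measure.integral_compProd (Integrable.of_bound (hφm m).aestronglyMeasurable 1
          (ae_of_all _ fun z => (hφ1 m z).le)),
        integral_map (hXm m) (hinner m).aestronglyMeasurable]
    change Tendsto (fun m => ∫ ω, φ m (fun i : Fin m => X i ω, P m ω) ∂μ) atTop _
    simp_rw [htower]
    have hlim : Tendsto (fun m =>
        ∫ ω, ∫ p, φ m (fun i : Fin m => X i ω, p) ∂(Q m fun i : Fin m => X i ω) ∂μ) atTop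
        (𝓝 (∫ _, ∫ ω', Complex.exp ((∑ j, t j * B (A j) ω' : ℝ) * Complex.I) ∂ν ∂μ)) := by
      refine tendsto_integral_of_dominated_convergence (fun _ => 1)
        (fun m => ((hinner m).measurable.comp_aemeasurable (hXm m)).aestronglyMeasurable)
        (integrable_const _) (fun m => ae_of_all _ fun ω => ?_) ?_
      · refine (norm_integral_le_of_norm_le_const
          (ae_of_all _ fun p => (hφ1 m _).le)).trans_eq ?_
        simp
      · filter_upwards [hcond] with ω hω
        exact hω t
    simpa using hlim
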